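/- Let $\lambda$ be the Lebesgue area measure on $\mathbb{C}$ and $d\mu(z)=\pi^{-1}e^{-|z|^2}\,d\lambda(z)$. Fix an integer $n\ge 1$, and let $F^2_n(\mathbb{C})$ be the $n$-analytic Fock space, i.e. the space of all functions $g\in L^2(\mathbb{C},d\mu)$ of class $C^n$ with $\partial^n g/\partial\bar z^n=0$ on $\mathbb{C}$, with the inner product $\langle g,h\rangle=\int_{\mathbb{C}} g\,\overline{h}\,d\mu$. Put $L^1_{n-1}(x)=\sum_{j=0}^{n-1}\binom{n}{n-1-j}\frac{(-x)^j}{j!}$, $K_n(z,w)=L^1_{n-1}(|z-w|^2)\,e^{z\overline{w}}$, and $k^n_z(w)=K_n(w,z)/\sqrt{K_n(z,z)}$. Let $p\in[1,\infty]$ and let $f\in L^p(\mathbb{C},d\lambda)$ be complex-valued. Then: 1. $K_n$ is the reproducing kernel of $F^2_n(\mathbb{C})$: $K_n(\cdot,w)\in F^2_n(\mathbb{C})$ and $g(w)=\langle g,K_n(\cdot,w)\rangle$ for all $w\in\mathbb{C}$ and $g\in F^2_n(\mathbb{C})$. 2. The Berezin transform $B_nf(z)=\langle f k^n_z,k^n_z\rangle=\int_{\mathbb{C}}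 f\,|k^n_z|^2\,d\mu$ is given by an absolutely convergent integral for every $z\in\mathbb{C}$, and $B_nf=f*b_n$ on $\mathbb{C}$, where $b_n(z)=\frac{e^{-|z|^2}}{n\pi}\,L^1_{n-1}(|z|^2)^2$. 3. $B_nf=f$ if and only if $f$ is harmonic on $\mathbb{C}$. This holds both for $f$ as an element of $L^p$ ($B_nf=f$ $\lambda$-almost everywhere if and only if $f$ coincides $\lambda$-almost everywhere with a harmonic function on $\mathbb{C}$) and for $f$ as a function ($B_nf=f$ at every point if and only if $f$ itself is harmonic on $\mathbb{C}$). -/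

import Mathlib

namespace PolyFock

noncomputable section

open MeasureTheory ComplexConjugate

/-- The Gaussian probability measure `dμ(z) = e^{-|z|²} / π dλ(z)` on the complex plane. -/
def gaussian : Measure ℂ :=
  volume.withDensity fun z => ENNReal.ofReal (Real.exp (-‖z‖ ^ 2) / Real.pi)

/-- The inner product of `L²(ℂ, dμ)`, linear in the first variable. It is written as an integral
because it is also used for pairs of functions whose product is only `μ`-integrable. -/
def inner (g h : ℂ → ℂ) : ℂ :=
  ∫ w, g w * conj (h w) ∂gaussian

/-- The Wirtinger derivative `∂/∂z̄ = (∂/∂x + i ∂/∂y) / 2`. -/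
def dbar (f : ℂ → ℂ) (z : ℂ) : ℂ :=
  (fderiv ℝ f z 1 + Complex.I * fderiv ℝ f z Complex.I) / 2

/-- `f` is `n`-analytic on `ℂ`: it is of class `C^n` and `∂ⁿf/∂z̄ⁿ = 0`. -/
def IsNAnalytic (n : ℕ) (f : ℂ → ℂ) : Prop :=
  ContDiff ℝ n f ∧ ∀ z, dbar^[n] f z = 0

/-- The `n`-analytic Fock space: all `n`-analytic functions that are square integrable
with respect to the Gaussian measure. -/
def fockSpace (n : ℕ) : Set (ℂ → ℂ) :=
  {g | IsNAnalytic n g ∧ MemLp g 2 gaussian}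

/-- `K` is the reproducing kernel of the space `H` of functions on `ℂ`, for the inner product of
`L²(ℂ, dμ)`. -/
def IsReproducingKernel (H : Set (ℂ → ℂ)) (K : ℂ → ℂ → ℂ) : Prop :=
  (∀ w, (fun z => K z w) ∈ H) ∧ ∀ g ∈ H, ∀ w, g w = inner g fun z => K z w

/-- The generalized Laguerre polynomial `L^β_k`, for a natural number `β`. -/
def laguerre (β k : ℕ) (x : ℝ) : ℝ :=
  ∑ j ∈ Finset.range (k + 1), ((k + β).choose (k - j) : ℝ) * ((-x) ^ j / (j.factorial : ℝ))

/-- The kernel `K_n(z, w) = L^1_{n-1}(|z - w|²) e^{z w̄}`. -/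
def kernel (n : ℕ) (z w : ℂ) : ℂ :=
  (laguerre 1 (n - 1) (‖z - w‖ ^ 2) : ℂ) * Complex.exp (z * conj w)

/-- The normalized kernel `k_z(w) = K_n(w, z) / √K_n(z, z)`; the number `K_n(z, z)` is real. -/
def normalizedKernel (n : ℕ) (z w : ℂ) : ℂ :=
  kernel n w z / (Real.sqrt (kernel n z z).re : ℂ)

/-- The Berezin transform `B_n f(z) = ⟨f k_z, k_z⟩`. -/
def berezin (n : ℕ) (f : ℂ → ℂ) (z : ℂ) : ℂ :=
  inner (fun w => f w * normalizedKernel n z w) (normalizedKernel n z)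

/-- The function `b_n(z) = e^{-|z|²} L^1_{n-1}(|z|²)² / (nπ)`. -/
def berezinDensity (n : ℕ) (z : ℂ) : ℝ :=
  Real.exp (-‖z‖ ^ 2) / (n * Real.pi) * laguerre 1 (n - 1) (‖z‖ ^ 2) ^ 2

end

end PolyFock

namespace PolyFock

noncomputable section

open MeasureTheory ComplexConjugate

/-! An `n`-analytic `g` is `∑ conj (z - w) ^ k * h k z` over `k < n`, with entire `h k`. After
translation by `w`, the reproducing integral pairs such a sum with a radial weight times a
holomorphic exponential. Averaging over circles leaves radial moments of the weight, and Laguerre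
orthogonality kills all of them except `k = 0`, which gives `g w` by the mean value property.

Completing the square turns `|k_z|² dμ` into a translate of `b_n`, so the Berezin transform is
convolution with an even, radial function. It has mass one because the kernel reproduces itself at
`0`. Harmonic functions are therefore fixed, by the mean value property. Conversely, if `B_n f = f`
almost everywhere, then by Hölder `B_n f` is a bounded, everywhere defined fixed point, and the
Choquet–Deny theorem (`ae_sub_eq_of_eq_integral_sub`) makes it constant, since `b_n > 0` almost
everywhere. -/

/-! ### Wirtinger calculus and the structure of `n`-analytic functions -/

theorem contDiff_dbar {n : ℕ} {f : ℂ → ℂ} (hf : ContDiff ℝ (n + 1 : ℕ) f) :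
    ContDiff ℝ n (dbar f) := by
  have h := hf.fderiv_right (m := n) (by norm_cast)
  unfold PolyFock.dbar
  exact ((h.clm_apply contDiff_const).add
    (contDiff_const.mul (h.clm_apply contDiff_const))).div_const 2

theorem dbar_add {f g : ℂ → ℂ} (hf : Differentiable ℝ f) (hg : Differentiable ℝ g) :
    dbar (f + g) = dbar f + dbar g := by
  ext z
  simp only [dbar, Pi.add_apply, fderiv_add (hf z) (hg z), add_apply]
  ring

theorem iterate_dbar_add (n : ℕ) {f g : ℂ → ℂ} (hf : ContDiff ℝ n f) (hg : ContDiff ℝ n g) :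
    dbar^[n] (f + g) = dbar^[n] f + dbar^[n] g := by
  induction n generalizing f g with
  | zero => rfl
  | succ n ih =>
    simp only [Function.iterate_succ_apply]
    rw [dbar_add (hf.differentiable (by simp)) (hg.differentiable (by simp)),
      ih (contDiff_dbar hf) (contDiff_dbar hg)]

theorem iterate_dbar_zero (n : ℕ) : dbar^[n] (0 : ℂ → ℂ) = 0 := by
  induction n with
  | zero => rfl
  | succ n ih =>
    rw [Function.iterate_succ_apply]
    convert ih using 2
    ext z
    simp [dbar]

theorem iterate_dbar_sum (n : ℕ) {ι : Type*} (s : Finset ι) {f : ι → ℂ → ℂ}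
    (hf : ∀ i ∈ s, ContDiff ℝ n (f i)) :
    dbar^[n] (∑ i ∈ s, f i) = ∑ i ∈ s, dbar^[n] (f i) := by
  classical
  induction s using Finset.induction_on with
  | empty => simp [iterate_dbar_zero]
  | insert i s hi ih =>
    rw [Finset.sum_insert hi, Finset.sum_insert hi, iterate_dbar_add n (hf i (by simp)) ?_,
      ih fun j hj => hf j (by simp [hj])]
    have := ContDiff.sum (s := s) fun j hj => hf j (Finset.mem_insert_of_mem hj)
    convert this using 1
    ext z
    simp

/-- Holomorphic factors are constants for `dbar`. The truncated exponent at `k = 0` is harmless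
because of the factor `k`. -/
theorem dbar_conj_sub_pow_mul (w : ℂ) (k : ℕ) {h : ℂ → ℂ} (hh : Differentiable ℂ h) :
    dbar (fun z => conj (z - w) ^ k * h z) = fun z => conj (z - w) ^ (k - 1) * (k * h z) := by
  ext z
  have h1 : HasFDerivAt (fun z : ℂ => conj (z - w)) (Complex.conjCLE : ℂ →L[ℝ] ℂ) z :=
    (Complex.conjCLE : ℂ →L[ℝ] ℂ).hasFDerivAt.comp z ((hasFDerivAt_id z).sub_const w)
  have h2 : HasFDerivAt h ((fderiv ℂ h z).restrictScalars ℝ) z :=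
    (hh z).hasFDerivAt.restrictScalars ℝ
  have hI : fderiv ℂ h z Complex.I = Complex.I * fderiv ℂ h z 1 := by
    rw [← smul_eq_mul, ← map_smul, smul_eq_mul, mul_one]
  have h3 : HasFDerivAt (fun z => conj (z - w) ^ k * h z) _ z := (h1.pow k).mul h2
  rw [dbar, h3.fderiv]
  simp [hI]
  linear_combination (-(conj z - conj w) ^ k * deriv h z / 2 +
    h z * k * (conj z - conj w) ^ (k - 1) / 2) * (-Complex.I_sq)

theorem iterate_dbar_conj_sub_pow_mul (w : ℂ) (k m : ℕ) {h : ℂ → ℂ} (hh : Differentiable ℂ h) :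
    dbar^[m] (fun z => conj (z - w) ^ k * h z) =
      fun z => conj (z - w) ^ (k - m) * (k.descFactorial m * h z) := by
  induction m with
  | zero => simp
  | succ m ih =>
    rw [Function.iterate_succ_apply', ih, dbar_conj_sub_pow_mul _ _ (hh.const_mul _)]
    ext z
    rw [Nat.descFactorial_succ, Nat.sub_sub]
    push_cast
    ring

theorem contDiff_conj_sub_pow_mul (w : ℂ) (k : ℕ) {h : ℂ → ℂ} (hh : Differentiable ℂ h)
    (m : ℕ) : ContDiff ℝ m (fun z => conj (z - w) ^ k * h z) := by
  have h2 : ContDiff ℝ m h := (hh.contDiff (n := m)).restrict_scalars ℝ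
  have h1 : ContDiff ℝ m (fun z : ℂ => conj (z - w)) :=
    Complex.conjCLE.contDiff.comp (contDiff_id.sub contDiff_const)
  exact (h1.pow k).mul h2

/-- The Cauchy–Riemann equation. -/
theorem differentiable_of_dbar_eq_zero {f : ℂ → ℂ} (hf : Differentiable ℝ f)
    (h : ∀ z, dbar f z = 0) : Differentiable ℂ f := by
  intro z
  have hz := h z
  have hI : fderiv ℝ f z Complex.I = Complex.I * fderiv ℝ f z 1 := by
    rw [dbar] at hz
    linear_combination (-2 * Complex.I) * hz + fderiv ℝ f z Complex.I * Complex.I_sq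
  refine (hasFDerivAt_of_restrictScalars ℝ (hf z).hasFDerivAt
    (f' := ContinuousLinearMap.toSpanSingleton ℂ (fderiv ℝ f z 1)) ?_).differentiableAt
  ext x
  have hx : (x.re • (1 : ℂ) + x.im • Complex.I : ℂ) = x := by simp
  conv_rhs => rw [← hx, map_add, map_smul, map_smul, hI]
  simp
  linear_combination (-fderiv ℝ f z 1) * Complex.re_add_im x

theorem isNAnalytic_sum (n : ℕ) (w : ℂ) {h : ℕ → ℂ → ℂ} (hh : ∀ k, Differentiable ℂ (h k)) :
    IsNAnalytic n (fun z => ∑ k ∈ Finset.range n, conj (z - w) ^ k * h k z) := by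
  refine ⟨ContDiff.sum fun k _ => contDiff_conj_sub_pow_mul w k (hh k) n, fun z => ?_⟩
  have : (fun z => ∑ k ∈ Finset.range n, conj (z - w) ^ k * h k z) =
      ∑ k ∈ Finset.range n, fun z => conj (z - w) ^ k * h k z := by
    ext z; simp
  rw [this, iterate_dbar_sum n _ fun k _ => contDiff_conj_sub_pow_mul w k (hh k) n,
    Finset.sum_apply]
  refine Finset.sum_eq_zero fun k hk => ?_
  rw [iterate_dbar_conj_sub_pow_mul w k n (hh k),
    Nat.descFactorial_of_lt (Finset.mem_range.1 hk)]
  simp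

/-- An `n`-analytic function is a polynomial of degree less than `n` in `conj (z - w)` whose
coefficients are entire functions. -/
theorem IsNAnalytic.exists_eq_sum (w : ℂ) {n : ℕ} {g : ℂ → ℂ} (hg : IsNAnalytic n g) :
    ∃ h : ℕ → ℂ → ℂ, (∀ k, Differentiable ℂ (h k)) ∧
      ∀ z, g z = ∑ k ∈ Finset.range n, conj (z - w) ^ k * h k z := by
  induction n generalizing g with
  | zero => exact ⟨fun _ _ => 0, fun _ => differentiable_const 0, fun z => by simpa using hg.2 z⟩
  | succ n ih =>
    have hC : ∀ (m : ℕ) {f : ℂ → ℂ}, ContDiff ℝ (1 + m : ℕ) f →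
        ContDiff ℝ (1 : ℕ) (dbar^[m] f) := by
      intro m
      induction m with
      | zero => intro f hf; simpa using hf
      | succ m ihm => intro f hf; exact ihm (contDiff_dbar hf)
    have hq : Differentiable ℂ (dbar^[n] g) := by
      refine differentiable_of_dbar_eq_zero
        ((hC n (by simpa [add_comm] using hg.1)).differentiable (by simp)) fun z => ?_
      rw [← Function.iterate_succ_apply' dbar n g]
      exact hg.2 z
    -- The top coefficient: `dbar^[n]` sends `conj (z - w) ^ n * q` to `n! * q`, so subtracting this
    -- term leaves an `n`-analytic function.
    set q : ℂ → ℂ := fun z => (n.factorial : ℂ)⁻¹ * (dbar^[n] g) z with hqdef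
    have hq' : Differentiable ℂ q := hq.const_mul _
    have hnq : Differentiable ℂ fun z => -q z := hq'.neg
    have hr : IsNAnalytic n (g + fun z => conj (z - w) ^ n * (-q z)) := by
      have hgn : ContDiff ℝ n g := hg.1.of_le (by norm_cast; omega)
      refine ⟨hgn.add (contDiff_conj_sub_pow_mul w n hnq n), fun z => ?_⟩
      rw [iterate_dbar_add n hgn (contDiff_conj_sub_pow_mul w n hnq n),
        iterate_dbar_conj_sub_pow_mul w n n hnq, Pi.add_apply, Nat.descFactorial_self]
      have : (n.factorial : ℂ) ≠ 0 := by exact_mod_cast n.factorial_ne_zero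
      simp [hqdef, this]
    obtain ⟨h, hh, hsum⟩ := ih hr
    refine ⟨fun k => if k = n then q else h k, fun k => ?_, fun z => ?_⟩
    · dsimp only; split_ifs
      exacts [hq', hh k]
    · have := hsum z
      rw [Pi.add_apply] at this
      rw [Finset.sum_range_succ, Finset.sum_congr rfl (g := fun k => conj (z - w) ^ k * h k z)]
      · rw [← this]; simp
      · intro k hk
        simp [(Finset.mem_range.1 hk).ne]

/-! ### Choquet–Deny by a variance argument -/

theorem integral_sub_const_sq {α : Type*} [MeasurableSpace α] {ν : Measure α}
    [IsProbabilityMeasure ν] {s : α → ℝ} (hs : Integrable s ν)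
    (hs2 : Integrable (fun y => s y ^ 2) ν) (c : ℝ) :
    ∫ y, (s y - c) ^ 2 ∂ν = ∫ y, s y ^ 2 ∂ν - 2 * c * ∫ y, s y ∂ν + c ^ 2 := by
  have e : ∀ y, (s y - c) ^ 2 = s y ^ 2 - 2 * c * s y + c ^ 2 := fun y => by ring
  have i : Integrable (fun y => s y ^ 2 - 2 * c * s y) ν := hs2.sub (hs.const_mul _)
  simp only [e]
  rw [integral_add i (integrable_const _), integral_sub hs2 (hs.const_mul _), integral_const_mul]
  simp

/-- **Choquet–Deny**: a bounded function on an abelian group that is reproduced by convolution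
with a probability measure `ν` is `ν`-almost invariant. -/
theorem ae_sub_eq_of_eq_integral_sub {G : Type*} [AddCommGroup G] [MeasurableSpace G]
    [MeasurableSub₂ G] {ν : Measure G} [IsProbabilityMeasure ν] {u : G → ℝ} (hu : Measurable u)
    {C : ℝ} (hC : ∀ x, |u x| ≤ C) (h : ∀ x, u x = ∫ y, u (x - y) ∂ν) (x : G) :
    ∀ᵐ y ∂ν, u (x - y) = u x := by
  have hint : ∀ {s : G → ℝ} {D : ℝ}, Measurable s → (∀ y, |s y| ≤ D) → Integrable s ν :=
    fun hs hD => Integrable.of_bound hs.aestronglyMeasurable _ (Filter.Eventually.of_forall hD)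
  have hsub : ∀ x : G, Measurable fun y : G => x - y := fun x => by fun_prop
  have hC2 : ∀ x, |u x ^ 2| ≤ C ^ 2 := fun x => by
    rw [abs_pow]; exact pow_le_pow_left₀ (abs_nonneg _) (hC x) 2
  have hdiff : ∀ x y, |(u x - u y) ^ 2| ≤ (2 * C) ^ 2 := fun x y => by
    rw [abs_pow]
    refine pow_le_pow_left₀ (abs_nonneg _) ?_ 2
    have := abs_sub (u x) (u y)
    linarith [hC x, hC y]
  set v : G → ℝ := fun x => ∫ y, (u (x - y) - u x) ^ 2 ∂ν with hv
  have hvm : Measurable v := by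
    have : Measurable fun q : G × G => (u (q.1 - q.2) - u q.1) ^ 2 := by fun_prop
    exact this.stronglyMeasurable.integral_prod_right'.measurable
  have hvb : ∀ x, |v x| ≤ (2 * C) ^ 2 := fun x => by
    have := norm_integral_le_of_norm_le_const (μ := ν) (f := fun y => (u (x - y) - u x) ^ 2)
      (Filter.Eventually.of_forall fun y => hdiff (x - y) x)
    simpa using this
  -- the defect `v` of `u ^ 2` is subharmonic
  have hsq : ∀ x, ∫ y, u (x - y) ^ 2 ∂ν = u x ^ 2 + v x := fun x => by
    have i1 : Integrable (fun y => u (x - y) ^ 2) ν :=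
      hint ((hu.comp (hsub x)).pow_const 2) fun y => hC2 _
    simp only [hv]
    rw [integral_sub_const_sq (s := fun y => u (x - y))
      (hint (hu.comp (hsub x)) fun y => hC _) i1, ← h x]
    ring
  have hjensen : ∀ x, v x ≤ ∫ z, v (x - z) ∂ν := fun x => by
    have hmeas : Measurable fun q : G × G => (u (x - q.1 - q.2) - u (x - q.1)) ^ 2 := by fun_prop
    have hprod : Integrable (Function.uncurry fun z y => (u (x - z - y) - u (x - z)) ^ 2)
        (ν.prod ν) :=
      Integrable.of_bound hmeas.aestronglyMeasurable ((2 * C) ^ 2)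
        (Filter.Eventually.of_forall fun q => hdiff _ _)
    simp only [hv]
    rw [integral_integral_swap hprod]
    refine integral_mono (hint (by fun_prop) fun y => hdiff _ _) hprod.integral_prod_right
      fun y => ?_
    -- For fixed `y`, the mean of `d` is `u (x - y) - u x`, because `u` is reproduced at both
    -- points; nonnegativity of the variance of `d` is then the required inequality.
    set d : G → ℝ := fun z => u (x - z - y) - u (x - z) with hd
    have i1 : Integrable (fun z => u (x - z - y)) ν := hint (by fun_prop) fun z => hC _
    have i2 : Integrable (fun z => u (x - z)) ν := hint (by fun_prop) fun z => hC _
    have hdi : ∫ z, d z ∂ν = u (x - y) - u x := by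
      rw [integral_sub i1 i2, ← h x, h (x - y)]
      simp only [sub_right_comm]
    have i3 : Integrable (fun z => d z ^ 2) ν := hint (by fun_prop) fun z => hdiff _ _
    have hnn : 0 ≤ ∫ z, (d z - (u (x - y) - u x)) ^ 2 ∂ν := integral_nonneg fun z => sq_nonneg _
    rw [integral_sub_const_sq (s := d) (i1.sub i2) i3, hdi] at hnn
    dsimp only
    linarith
  -- iterating gives `k * v ≤ 2 * C ^ 2` for every `k`
  have hiter : ∀ k : ℕ, ∃ s : G → ℝ, Measurable s ∧ (∀ x, |s x| ≤ C ^ 2) ∧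
      ∀ x, u x ^ 2 + k * v x ≤ s x := by
    intro k
    induction k with
    | zero => exact ⟨fun x => u x ^ 2, hu.pow_const 2, hC2, fun x => by simp⟩
    | succ k ih =>
      obtain ⟨s, hsm, hsb, hs⟩ := ih
      -- Averaging preserves the bound on `s`. On the left, averaging `u ^ 2` gains one `v`, and
      -- averaging `k * v` does not decrease it.
      refine ⟨fun x => ∫ y, s (x - y) ∂ν, ?_, fun x => ?_, fun x => ?_⟩
      · have : Measurable fun q : G × G => s (q.1 - q.2) := by fun_prop
        exact this.stronglyMeasurable.integral_prod_right'.measurable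
      · have := norm_integral_le_of_norm_le_const (μ := ν) (f := fun y => s (x - y))
          (Filter.Eventually.of_forall fun y => hsb (x - y))
        simpa using this
      · have i1 : Integrable (fun y => u (x - y) ^ 2) ν := hint (by fun_prop) fun y => hC2 _
        have i2 : Integrable (fun y => k * v (x - y)) ν :=
          (hint (by fun_prop) fun y => hvb (x - y)).const_mul _
        have i3 : Integrable (fun y => s (x - y)) ν := hint (by fun_prop) fun y => hsb _
        have hm := integral_mono (i1.add i2) i3 fun y => hs (x - y)
        simp only [Pi.add_apply] at hm
        rw [integral_add i1 i2, integral_const_mul, hsq x] at hm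
        have := mul_le_mul_of_nonneg_left (hjensen x) (Nat.cast_nonneg (α := ℝ) k)
        push_cast
        linarith
  have hv0 : v x = 0 := by
    refine le_antisymm (le_of_not_gt fun hpos => ?_) (integral_nonneg fun y => sq_nonneg _)
    obtain ⟨k, hk⟩ := exists_nat_gt (C ^ 2 / v x)
    obtain ⟨s, -, hsb, hs⟩ := hiter k
    rw [div_lt_iff₀ hpos] at hk
    linarith [hs x, (abs_le.1 (hsb x)).2, sq_nonneg (u x)]
  have := (integral_eq_zero_iff_of_nonneg (fun y => sq_nonneg (u (x - y) - u x))
    (hint (by fun_prop) fun y => hdiff _ _)).1 hv0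
  filter_upwards [this] with y hy
  exact sub_eq_zero.1 (pow_eq_zero_iff two_ne_zero |>.1 hy)

/-! ### Polar coordinates and circle averages -/

theorem integral_eq_integral_circleAverage {F : ℂ → ℂ} (hc : Continuous F) (hF : Integrable F) :
    ∫ z, F z = ∫ r in Set.Ioi (0 : ℝ), (2 * Real.pi * r : ℝ) • Real.circleAverage F 0 r := by
  have hpc : Continuous fun p : ℝ × ℝ => Complex.polarCoord.symm p := by
    simp only [Complex.polarCoord_symm_apply]
    fun_prop
  have hint : IntegrableOn (fun p : ℝ × ℝ => p.1 • F (Complex.polarCoord.symm p))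
      (Set.Ioi (0 : ℝ) ×ˢ Set.Ioo (-Real.pi) Real.pi) := by
    refine ⟨(continuous_fst.smul (hc.comp hpc)).aestronglyMeasurable, ?_⟩
    have h := hF.2
    rw [HasFiniteIntegral, ← Complex.lintegral_comp_polarCoord_symm, polarCoord_target] at h
    refine lt_of_eq_of_lt (setLIntegral_congr_fun (by measurability) fun p hp => ?_) h
    simp only [enorm_smul, smul_eq_mul]
    rw [Real.enorm_of_nonneg (le_of_lt hp.1)]
  rw [← Complex.integral_comp_polarCoord_symm, polarCoord_target]
  rw [Measure.volume_eq_prod] at hint ⊢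
  rw [setIntegral_prod _ hint]
  refine setIntegral_congr_fun measurableSet_Ioi fun r hr => ?_
  dsimp only
  rw [integral_smul, Real.circleAverage, smul_smul, ← integral_Ioc_eq_integral_Ioo,
    ← intervalIntegral.integral_of_le (by linarith [Real.pi_pos])]
  have hper : (fun θ => F (circleMap 0 r θ)).Periodic (2 * Real.pi) :=
    fun x => by simp [periodic_circleMap 0 r x]
  have e := hper.intervalIntegral_add_eq 0 (-Real.pi)
  rw [zero_add, show -Real.pi + 2 * Real.pi = Real.pi by ring] at e
  rw [e, show 2 * Real.pi * r * (2 * Real.pi)⁻¹ = r by field_simp]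
  congr 2
  ext θ
  congr 1
  simp [circleMap, Complex.exp_mul_I]

theorem circleAverage_radial_mul (φ : ℝ → ℂ) (F : ℂ → ℂ) {r : ℝ} (hr : 0 ≤ r) :
    Real.circleAverage (fun z => φ ‖z‖ * F z) 0 r = φ r * Real.circleAverage F 0 r := by
  simp [Real.circleAverage, abs_of_nonneg hr]
  ring

/-- On the circle of radius `r`, `conj z = r² / z`, and the average of `h z / z ^ k` does not depend
on the radius, by Cauchy's theorem on an annulus. -/
theorem circleAverage_conj_pow_mul (k : ℕ) {h : ℂ → ℂ} (hh : Differentiable ℂ h) {r : ℝ}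
    (hr : 0 < r) : Real.circleAverage (fun z => conj z ^ k * h z) 0 r =
      (r : ℂ) ^ (2 * k) * Real.circleAverage (fun z => (z ^ k)⁻¹ * h z) 0 1 := by
  have hann : ∀ {s t : ℝ}, 0 < s → s ≤ t →
      Real.circleAverage (fun z => (z ^ k)⁻¹ * h z) 0 t =
        Real.circleAverage (fun z => (z ^ k)⁻¹ * h z) 0 s := by
    intro s t hs hst
    have hd : ∀ z : ℂ, z ≠ 0 → DifferentiableAt ℂ (fun z => (z ^ k)⁻¹ * h z) z := fun z hz =>
      ((differentiableAt_id.pow k).inv (pow_ne_zero k hz)).mul (hh z)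
    rw [Real.circleAverage_eq_circleIntegral (hs.trans_le hst).ne',
      Real.circleAverage_eq_circleIntegral hs.ne',
      Complex.circleIntegral_sub_center_inv_smul_eq_of_differentiable_on_annulus_off_countable
        hs hst Set.countable_empty]
    · rintro z ⟨-, hz⟩
      refine (hd z ?_).continuousAt.continuousWithinAt
      rintro rfl
      exact hz (Metric.mem_ball_self hs)
    · rintro z ⟨⟨-, hz⟩, -⟩
      refine hd z ?_
      rintro rfl
      exact hz (Metric.mem_closedBall_self hs.le)
  have h1 : Real.circleAverage (fun z => (z ^ k)⁻¹ * h z) 0 r =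
      Real.circleAverage (fun z => (z ^ k)⁻¹ * h z) 0 1 := by
    rcases le_total r 1 with h | h
    · exact (hann hr h).symm
    · exact hann one_pos h
  rw [← h1]
  have h2 := circleAverage_radial_mul (fun r => (r : ℂ) ^ (2 * k)) (fun z => (z ^ k)⁻¹ * h z) hr.le
  rw [← h2]
  refine Real.circleAverage_congr_sphere fun z hz => ?_
  have hz0 : z ≠ 0 := by
    rintro rfl
    simp at hz
    exact hr.ne' (by simpa using hz.symm)
  rw [pow_mul, ← Complex.mul_conj', mul_pow]
  field_simp

/-! ### Gaussian moments and Laguerre orthogonality -/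

theorem integrableOn_pow_mul_exp_neg_sq (m : ℕ) :
    IntegrableOn (fun r : ℝ => 2 * (r ^ (2 * m + 1) * Real.exp (-r ^ 2))) (Set.Ioi 0) := by
  have := integrableOn_rpow_mul_exp_neg_rpow (p := 2) (s := (2 * m + 1 : ℕ))
    (by push_cast; linarith [Nat.cast_nonneg (α := ℝ) m]) (by norm_num)
  refine (this.congr_fun (fun r _ => ?_) measurableSet_Ioi).const_mul 2
  rw [Real.rpow_natCast, ← Real.rpow_natCast r 2]
  norm_num

theorem integral_pow_mul_exp_neg_sq (m : ℕ) :
    ∫ r in Set.Ioi (0 : ℝ), 2 * (r ^ (2 * m + 1) * Real.exp (-r ^ 2)) = m.factorial := by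
  have := integral_rpow_mul_exp_neg_rpow (p := 2) (q := (2 * m + 1 : ℕ)) (by norm_num)
    (by push_cast; linarith [Nat.cast_nonneg (α := ℝ) m])
  rw [integral_const_mul, setIntegral_congr_fun (g := fun r : ℝ => r ^ ((2 * m + 1 : ℕ) : ℝ) *
    Real.exp (-r ^ (2 : ℝ))) measurableSet_Ioi, this]
  · rw [show ((2 * m + 1 : ℕ) + 1 : ℝ) / 2 = m + 1 by push_cast; ring, Real.Gamma_nat_eq_factorial]
    ring
  · intro r _
    dsimp only
    rw [Real.rpow_natCast, ← Real.rpow_natCast r 2]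
    norm_num

/-- `(j + k)! / j!` is the rising factorial of `j + 1`, a polynomial of degree `k`, so its `(n +
1)`-st finite difference vanishes. The sum holds the nodes `1, …, n + 1`; the missing node `0`
supplies the right-hand side. -/
theorem sum_choose_mul_ascFactorial (n k : ℕ) (hk : k < n + 1) :
    ∑ j ∈ Finset.range (n + 1), ((n + 1).choose (n - j) : ℝ) * ((-1) ^ j / (j.factorial : ℝ)) *
      ((j + k).factorial : ℝ) = if k = 0 then 1 else 0 := by
  have h := congrFun (Polynomial.fwdDiff_iter_eq_zero_of_degree_lt (R := ℝ)
    (P := ascPochhammer ℝ k) (n := n + 1) (by rwa [ascPochhammer_natDegree])) 0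
  rw [fwdDiff_iter_eq_sum_shift, Finset.sum_range_succ'] at h
  have h0 : Polynomial.eval (0 : ℝ) (ascPochhammer ℝ k) = if k = 0 then 1 else 0 := by
    simp [ascPochhammer_eval_zero]
  rw [← h0]
  have key : ∀ j ∈ Finset.range (n + 1), ((n + 1).choose (n - j) : ℝ) *
      ((-1) ^ j / (j.factorial : ℝ)) * ((j + k).factorial : ℝ) = (-1) ^ n *
      (((-1 : ℤ) ^ (n + 1 - (j + 1)) * ((n + 1).choose (j + 1) : ℤ)) •
        Polynomial.eval (0 + (j + 1) • (1 : ℝ)) (ascPochhammer ℝ k)) := by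
    intro j hj
    have hjn : j ≤ n := Nat.lt_succ_iff.1 (Finset.mem_range.1 hj)
    rw [show (n + 1).choose (n - j) = (n + 1).choose (j + 1) from
      (Nat.choose_symm_of_eq_add (by omega))]
    rw [zero_add, nsmul_one, ← ascPochhammer_eval_cast, ascPochhammer_nat_eq_ascFactorial]
    have hf : ((j + k).factorial : ℝ) = j.factorial * (j + 1).ascFactorial k := by
      exact_mod_cast (Nat.factorial_mul_ascFactorial j k).symm
    have hs : ((-1 : ℝ) ^ j) = (-1) ^ n * (-1) ^ (n - j) := by
      rw [← pow_add, show n + (n - j) = j + 2 * (n - j) by omega, pow_add, pow_mul]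
      simp
    have hne : (j.factorial : ℝ) ≠ 0 := by exact_mod_cast j.factorial_ne_zero
    rw [hf, hs, Nat.add_sub_add_right, zsmul_eq_mul]
    push_cast
    field_simp
  rw [Finset.sum_congr rfl key, ← Finset.mul_sum, eq_neg_of_add_eq_zero_left h]
  simp only [zero_smul, add_zero, Nat.sub_zero, Nat.choose_zero_right, zsmul_eq_mul]
  push_cast
  have : ((-1 : ℝ) ^ n) * (-1) ^ n = 1 := by rw [← mul_pow]; simp
  rw [pow_succ]
  linear_combination (Polynomial.eval (0 : ℝ) (ascPochhammer ℝ k)) * this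

/-- The weight `2 r e^{-r²} L^1_n(r²)` reproduces the value at `0` of even polynomials of degree at
most `2 n`. -/
theorem integral_laguerre_mul_pow (n k : ℕ) (hk : k < n + 1) :
    IntegrableOn (fun r : ℝ => 2 * r * Real.exp (-r ^ 2) * laguerre 1 n (r ^ 2) * r ^ (2 * k))
      (Set.Ioi 0) ∧
    ∫ r in Set.Ioi (0 : ℝ), 2 * r * Real.exp (-r ^ 2) * laguerre 1 n (r ^ 2) * r ^ (2 * k) =
      if k = 0 then 1 else 0 := by
  have e : (fun r : ℝ => 2 * r * Real.exp (-r ^ 2) * laguerre 1 n (r ^ 2) * r ^ (2 * k)) =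
      fun r => ∑ j ∈ Finset.range (n + 1),
        ((n + 1).choose (n - j) : ℝ) * ((-1) ^ j / (j.factorial : ℝ)) *
          (2 * (r ^ (2 * (j + k) + 1) * Real.exp (-r ^ 2))) := by
    ext r
    rw [laguerre, Finset.mul_sum, Finset.sum_mul]
    refine Finset.sum_congr rfl fun j _ => ?_
    rw [neg_pow (r ^ 2)]
    ring
  have hi := fun j (_ : j ∈ Finset.range (n + 1)) =>
    (integrableOn_pow_mul_exp_neg_sq (j + k)).const_mul
      (((n + 1).choose (n - j) : ℝ) * ((-1) ^ j / (j.factorial : ℝ)))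
  rw [e]
  refine ⟨integrable_finsetSum _ hi, ?_⟩
  rw [integral_finsetSum _ hi, ← sum_choose_mul_ascFactorial n k hk]
  simp_rw [integral_const_mul, ← integral_const_mul (2 : ℝ), integral_pow_mul_exp_neg_sq]

/-! ### Growth of Laguerre polynomials and integrability of `b_n` -/

theorem continuous_laguerre (β k : ℕ) : Continuous (laguerre β k) := by
  unfold laguerre
  fun_prop

theorem laguerre_one_zero (m : ℕ) : laguerre 1 m 0 = m + 1 := by
  rw [laguerre, Finset.sum_range_succ', Finset.sum_eq_zero]
  · simp
  · intro j _
    simp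

/-- The rate `1 / 4` is chosen so that the square of the polynomial costs only half of the Gaussian
in `b_n`. -/
theorem abs_laguerre_le (β k : ℕ) :
    ∃ C, ∀ t, 0 ≤ t → |laguerre β k t| ≤ C * Real.exp (t / 4) := by
  refine ⟨∑ j ∈ Finset.range (k + 1), ((k + β).choose (k - j) : ℝ) * 4 ^ j, fun t ht => ?_⟩
  rw [laguerre, Finset.sum_mul]
  refine (Finset.abs_sum_le_sum_abs _ _).trans (Finset.sum_le_sum fun j _ => ?_)
  have h := Real.pow_div_factorial_le_exp (x := t / 4) (by positivity) j
  rw [abs_mul, abs_div, abs_pow, abs_neg, abs_of_nonneg ht, Nat.abs_cast, Nat.abs_cast, mul_assoc]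
  refine mul_le_mul_of_nonneg_left ?_ (Nat.cast_nonneg _)
  refine le_of_eq_of_le ?_ (mul_le_mul_of_nonneg_left h (by positivity : (0 : ℝ) ≤ 4 ^ j))
  rw [div_pow]
  field_simp

theorem integrable_exp_neg_mul_norm_sq {c : ℝ} (hc : 0 < c) :
    Integrable fun z : ℂ => Real.exp (-c * ‖z‖ ^ 2) := by
  have := (GaussianFourier.integrable_cexp_neg_mul_sq_norm_add (V := ℂ) (b := c)
    (by simpa using hc) 0 0).norm
  refine this.congr (Filter.Eventually.of_forall fun z => ?_)
  simp only [Complex.norm_exp]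
  norm_cast
  simp

theorem memLp_exp_neg_mul_norm_sq {c : ℝ} (hc : 0 < c) (q : ENNReal) :
    MemLp (fun z : ℂ => Real.exp (-c * ‖z‖ ^ 2)) q := by
  have hm : AEStronglyMeasurable (fun z : ℂ => Real.exp (-c * ‖z‖ ^ 2)) volume :=
    Continuous.aestronglyMeasurable (by fun_prop)
  rcases eq_or_ne q 0 with rfl | h0
  · exact memLp_zero_iff_aestronglyMeasurable.2 hm
  rcases eq_or_ne q ⊤ with rfl | ht
  · refine memLp_top_of_bound hm 1 (Filter.Eventually.of_forall fun z => ?_)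
    rw [Real.norm_of_nonneg (Real.exp_nonneg _)]
    exact Real.exp_le_one_iff.2 (by nlinarith [sq_nonneg ‖z‖])
  · rw [← integrable_norm_rpow_iff hm h0 ht]
    refine (integrable_exp_neg_mul_norm_sq
      (mul_pos hc (ENNReal.toReal_pos h0 ht))).congr (Filter.Eventually.of_forall fun z => ?_)
    dsimp only
    rw [Real.norm_of_nonneg (Real.exp_nonneg _), ← Real.exp_mul]
    ring_nf

theorem continuous_berezinDensity (n : ℕ) : Continuous (berezinDensity n) := by
  have := continuous_laguerre 1 (n - 1)
  unfold berezinDensity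
  fun_prop

theorem berezinDensity_nonneg (n : ℕ) (z : ℂ) : 0 ≤ berezinDensity n z := by
  unfold berezinDensity
  positivity

theorem berezinDensity_neg (n : ℕ) (z : ℂ) : berezinDensity n (-z) = berezinDensity n z := by
  simp [berezinDensity]

theorem memLp_berezinDensity (n : ℕ) (q : ENNReal) : MemLp (berezinDensity n) q := by
  obtain ⟨C, hC⟩ := abs_laguerre_le 1 (n - 1)
  refine ((memLp_exp_neg_mul_norm_sq (c := 1 / 2) (by norm_num) q).const_mul
    (C ^ 2 / (n * Real.pi))).of_le (continuous_berezinDensity n).aestronglyMeasurable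
    (Filter.Eventually.of_forall fun z => ?_)
  rw [Real.norm_of_nonneg (berezinDensity_nonneg n z), Real.norm_of_nonneg (by positivity),
    berezinDensity]
  have h := pow_le_pow_left₀ (abs_nonneg _) (hC (‖z‖ ^ 2) (by positivity)) 2
  rw [sq_abs, mul_pow, ← Real.exp_nat_mul] at h
  refine (mul_le_mul_of_nonneg_left h (by positivity)).trans (le_of_eq ?_)
  have e : Real.exp (-(1 / 2) * ‖z‖ ^ 2) =
      Real.exp (-‖z‖ ^ 2) * Real.exp ((2 : ℕ) * (‖z‖ ^ 2 / 4)) := by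
    rw [← Real.exp_add]
    congr 1
    push_cast
    ring
  rw [e]
  ring

/-! ### The kernel and its reproducing property -/

theorem integrable_gaussian_iff {g : ℂ → ℂ} : Integrable g gaussian ↔
    Integrable fun z => (Real.exp (-‖z‖ ^ 2) / Real.pi) • g z := by
  rw [gaussian, integrable_withDensity_iff_integrable_smul' (by fun_prop) (by simp)]
  refine integrable_congr (Filter.Eventually.of_forall fun z => ?_)
  dsimp only
  rw [ENNReal.toReal_ofReal (by positivity)]

theorem integral_gaussian (g : ℂ → ℂ) : ∫ z, g z ∂gaussian =
    ∫ z, (Real.exp (-‖z‖ ^ 2) / Real.pi) • g z := by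
  rw [gaussian, integral_withDensity_eq_integral_toReal_smul (by fun_prop) (by simp)]
  refine integral_congr_ae (Filter.Eventually.of_forall fun z => ?_)
  dsimp only
  rw [ENNReal.toReal_ofReal (by positivity)]

/-- Completing the square: `-|w|² + 2 Re (w z̄) = |z|² - |w - z|²`. -/
theorem exp_mul_kernel_mul_conj (n : ℕ) (z w : ℂ) :
    (Real.exp (-‖w‖ ^ 2) : ℂ) * (kernel n w z * conj (kernel n w z)) =
      Real.exp (‖z‖ ^ 2) * (Real.exp (-‖w - z‖ ^ 2) *
        laguerre 1 (n - 1) (‖w - z‖ ^ 2) ^ 2 : ℝ) := by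
  simp only [kernel, map_mul, Complex.conj_ofReal, ← Complex.exp_conj, Complex.conj_conj]
  push_cast
  rw [← Complex.mul_conj' w, ← Complex.mul_conj' z, ← Complex.mul_conj' (w - z)]
  have e : Complex.exp (-(w * conj w)) * (Complex.exp (w * conj z) * Complex.exp (conj w * z)) =
      Complex.exp (z * conj z) * Complex.exp (-((w - z) * conj (w - z))) := by
    simp only [← Complex.exp_add, map_sub]
    congr 1
    ring
  linear_combination (laguerre 1 (n - 1) (‖w - z‖ ^ 2) : ℂ) ^ 2 * e

theorem kernel_self (n : ℕ) (hn : 1 ≤ n) (z : ℂ) :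
    kernel n z z = ((n * Real.exp (‖z‖ ^ 2) : ℝ) : ℂ) := by
  obtain ⟨m, rfl⟩ := Nat.exists_eq_add_of_le' hn
  simp [kernel, laguerre_one_zero, Complex.mul_conj']

theorem exp_div_pi_mul_normalizedKernel (n : ℕ) (hn : 1 ≤ n) (z w : ℂ) :
    ((Real.exp (-‖w‖ ^ 2) / Real.pi : ℝ) : ℂ) *
      (normalizedKernel n z w * conj (normalizedKernel n z w)) = berezinDensity n (w - z) := by
  have h := exp_mul_kernel_mul_conj n z w
  have hpos : 0 ≤ n * Real.exp (‖z‖ ^ 2) := by positivity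
  have hs : ((Real.sqrt (n * Real.exp (‖z‖ ^ 2)) : ℝ) : ℂ) ^ 2 = n * Real.exp (‖z‖ ^ 2) := by
    rw [← Complex.ofReal_pow, Real.sq_sqrt hpos]
    push_cast
    rfl
  have hn0 : (n : ℂ) ≠ 0 := by exact_mod_cast (by omega : n ≠ 0)
  have he : (Real.exp (‖z‖ ^ 2) : ℂ) ≠ 0 := by exact_mod_cast (Real.exp_pos _).ne'
  have hpi : (Real.pi : ℂ) ≠ 0 := by exact_mod_cast Real.pi_ne_zero
  rw [normalizedKernel, kernel_self n hn, Complex.ofReal_re, map_div₀, Complex.conj_ofReal,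
    div_mul_div_comm, ← sq ((Real.sqrt (n * Real.exp (‖z‖ ^ 2)) : ℝ) : ℂ), hs]
  have h2 : (berezinDensity n (w - z) : ℂ) = (Real.exp (-‖w - z‖ ^ 2) *
      laguerre 1 (n - 1) (‖w - z‖ ^ 2) ^ 2 : ℝ) / (n * Real.pi) := by
    rw [berezinDensity]
    push_cast
    ring
  rw [h2, Complex.ofReal_div]
  field_simp
  linear_combination h

theorem kernel_mem_fockSpace (n : ℕ) (hn : 1 ≤ n) (w : ℂ) :
    (fun z => kernel n z w) ∈ fockSpace n := by
  obtain ⟨m, rfl⟩ := Nat.exists_eq_add_of_le' hn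
  have hcont : Continuous fun z => kernel (m + 1) z w := by
    have := continuous_laguerre 1 m
    simp only [kernel, Nat.add_sub_cancel]
    fun_prop
  constructor
  · have := isNAnalytic_sum (m + 1) w (h := fun k z =>
      ((m + 1).choose (m - k) : ℂ) * ((-(z - w)) ^ k / (k.factorial : ℂ)) *
        Complex.exp (z * conj w)) fun k => by fun_prop
    convert this using 2 with z
    rw [kernel, Nat.add_sub_cancel, laguerre]
    push_cast
    rw [Finset.sum_mul, ← Complex.mul_conj' (z - w)]
    refine Finset.sum_congr rfl fun k _ => ?_
    rw [← neg_mul, mul_pow]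
    ring
  · have hm : AEStronglyMeasurable (fun z => kernel (m + 1) z w) gaussian :=
      hcont.aestronglyMeasurable
    have hL2 : Integrable (fun z => kernel (m + 1) z w * conj (kernel (m + 1) z w)) gaussian := by
      rw [integrable_gaussian_iff]
      -- The constant is `K_n(w, w)`: the density of `|K_n(·, w)|² dμ` is `K_n(w, w)` times a
      -- translate of `b_n`.
      have hb := ((memLp_one_iff_integrable.1
        (memLp_berezinDensity (m + 1) 1)).comp_sub_right w).const_mul
        (Real.exp (‖w‖ ^ 2) * (m + 1))
      refine hb.ofReal.congr (Filter.Eventually.of_forall fun z => ?_)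
      have h := exp_mul_kernel_mul_conj (m + 1) w z
      have hpi : (Real.pi : ℂ) ≠ 0 := by exact_mod_cast Real.pi_ne_zero
      have hm0 : (m + 1 : ℂ) ≠ 0 := by exact_mod_cast m.succ_ne_zero
      simp only [berezinDensity, Complex.real_smul, RCLike.ofReal_eq_complex_ofReal]
      rw [Complex.ofReal_div, div_mul_eq_mul_div (Real.exp (-‖z‖ ^ 2) : ℂ), h]
      push_cast
      field_simp
    rw [memLp_two_iff_integrable_sq_norm hm]
    refine hL2.re.congr (Filter.Eventually.of_forall fun z => ?_)
    dsimp only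
    rw [Complex.mul_conj']
    norm_cast

/-- After recentring at `w`, the only nonradial factor left is holomorphic in `u`, so it can be
absorbed into the entire coefficients of `g`. -/
theorem exp_mul_conj_kernel_add (n : ℕ) (u w : ℂ) :
    ((Real.exp (-‖u + w‖ ^ 2) : ℝ) : ℂ) * conj (kernel n (u + w) w) =
      ((Real.exp (-‖u‖ ^ 2) * laguerre 1 (n - 1) (‖u‖ ^ 2) : ℝ) : ℂ) *
        Complex.exp (-(u * conj w)) := by
  simp only [kernel, map_mul, Complex.conj_ofReal, ← Complex.exp_conj, Complex.conj_conj,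
    add_sub_cancel_right]
  push_cast
  rw [← Complex.mul_conj' (u + w), ← Complex.mul_conj' u]
  have e : Complex.exp (-((u + w) * conj (u + w))) * Complex.exp (conj (u + w) * w) =
      Complex.exp (-(u * conj u)) * Complex.exp (-(u * conj w)) := by
    simp only [← Complex.exp_add, map_add]
    congr 1
    ring
  linear_combination (laguerre 1 (n - 1) (‖u‖ ^ 2) : ℂ) * e

theorem isReproducingKernel_kernel (n : ℕ) (hn : 1 ≤ n) :
    IsReproducingKernel (fockSpace n) (kernel n) := by
  refine ⟨kernel_mem_fockSpace n hn, fun g hg w => ?_⟩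
  have hK := kernel_mem_fockSpace n hn w
  obtain ⟨m, rfl⟩ := Nat.exists_eq_add_of_le' hn
  obtain ⟨h, hh, hsum⟩ := hg.1.exists_eq_sum w
  have hLc := continuous_laguerre 1 m
  set φ : ℝ → ℂ := fun r => ((Real.exp (-r ^ 2) / Real.pi * laguerre 1 m (r ^ 2) : ℝ) : ℂ) with hφ
  set q : ℕ → ℂ → ℂ := fun k u => h k (u + w) * Complex.exp (-(u * conj w)) with hq
  have hqd : ∀ k, Differentiable ℂ (q k) := fun k =>
    ((hh k).comp (differentiable_id.add_const w)).mul (by fun_prop)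
  have key : ∀ u, (Real.exp (-‖u + w‖ ^ 2) / Real.pi) • (g (u + w) *
      conj (kernel (m + 1) (u + w) w)) =
      φ ‖u‖ * ∑ k ∈ Finset.range (m + 1), conj u ^ k * q k u := by
    intro u
    have e := exp_mul_conj_kernel_add (m + 1) u w
    have e2 : ∑ k ∈ Finset.range (m + 1), conj u ^ k * q k u =
        g (u + w) * Complex.exp (-(u * conj w)) := by
      rw [hsum, Finset.sum_mul, add_sub_cancel_right]
      exact Finset.sum_congr rfl fun k _ => by simp only [hq]; ring
    rw [e2, Complex.real_smul]
    simp only [hφ, Nat.add_sub_cancel] at e ⊢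
    push_cast at e ⊢
    linear_combination (g (u + w) / Real.pi) * e
  -- Only the whole sum is known to be integrable, by Cauchy–Schwarz; its terms are separated after
  -- circle averaging, where each is a polynomial times a Gaussian in `r`.
  have hint : Integrable fun u => φ ‖u‖ * ∑ k ∈ Finset.range (m + 1), conj u ^ k * q k u := by
    have := hg.2.integrable_mul hK.2.star
    have := (integrable_gaussian_iff.1 this).comp_add_right w
    exact this.congr (Filter.Eventually.of_forall key)
  have hsc : Continuous fun u => ∑ k ∈ Finset.range (m + 1), conj u ^ k * q k u :=
    continuous_finsetSum _ fun k _ =>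
      (Complex.continuous_conj.pow k).mul (hqd k).continuous
  have hcont : Continuous fun u => φ ‖u‖ * ∑ k ∈ Finset.range (m + 1), conj u ^ k * q k u := by
    refine Continuous.mul ?_ hsc
    simp only [hφ]
    fun_prop
  set c : ℕ → ℂ := fun k => Real.circleAverage (fun z => (z ^ k)⁻¹ * q k z) 0 1 with hc
  have hc0 : c 0 = g w := by
    have hd : DiffContOnCl ℂ (q 0) (Metric.ball 0 |1|) := (hqd 0).diffContOnCl
    have : g w = q 0 0 := by
      rw [hsum, Finset.sum_range_succ', Finset.sum_eq_zero fun k _ => by simp]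
      simp [hq]
    rw [this, ← hd.circleAverage]
    simp [hc]
  have havg : ∀ r ∈ Set.Ioi (0 : ℝ), (2 * Real.pi * r : ℝ) • Real.circleAverage
      (fun u => φ ‖u‖ * ∑ k ∈ Finset.range (m + 1), conj u ^ k * q k u) 0 r =
      ∑ k ∈ Finset.range (m + 1),
        ((2 * r * Real.exp (-r ^ 2) * laguerre 1 m (r ^ 2) * r ^ (2 * k) : ℝ) : ℂ) * c k := by
    intro r hr
    have e : (fun u => ∑ k ∈ Finset.range (m + 1), conj u ^ k * q k u) =
        ∑ k ∈ Finset.range (m + 1), fun u => conj u ^ k * q k u := by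
      ext u; simp
    have hci : ∀ k ∈ Finset.range (m + 1),
        CircleIntegrable (fun u => conj u ^ k * q k u) 0 r := fun k _ =>
      (((Complex.continuous_conj.pow k).mul
        (hqd k).continuous).continuousOn).circleIntegrable (le_of_lt hr)
    rw [circleAverage_radial_mul φ _ (le_of_lt hr), e, Real.circleAverage_sum hci,
      Complex.real_smul, Finset.mul_sum, Finset.mul_sum]
    refine Finset.sum_congr rfl fun k _ => ?_
    have hpi : (Real.pi : ℂ) ≠ 0 := by exact_mod_cast Real.pi_ne_zero
    rw [circleAverage_conj_pow_mul k (hqd k) hr]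
    simp only [hφ, hc]
    push_cast
    field_simp
  rw [inner, integral_gaussian, ← integral_add_right_eq_self _ w]
  simp_rw [key]
  rw [integral_eq_integral_circleAverage hcont hint,
    setIntegral_congr_fun measurableSet_Ioi havg, integral_finsetSum]
  · rw [Finset.sum_congr rfl (g := fun k => (if k = 0 then 1 else 0) * c k)]
    · simp [hc0]
    · intro k hk
      rw [integral_mul_const, integral_complex_ofReal,
        (integral_laguerre_mul_pow m k (Finset.mem_range.1 hk)).2]
      split_ifs <;> simp
  · intro k hk
    exact (integral_laguerre_mul_pow m k (Finset.mem_range.1 hk)).1.ofReal.mul_const _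

/-! ### `b_n` as a probability density -/

theorem integrable_berezinDensity (n : ℕ) : Integrable (berezinDensity n) :=
  memLp_one_iff_integrable.1 (memLp_berezinDensity n 1)

theorem integral_berezinDensity (n : ℕ) (hn : 1 ≤ n) : ∫ z, berezinDensity n z = 1 := by
  have h := (isReproducingKernel_kernel n hn).2 _ (kernel_mem_fockSpace n hn 0) 0
  rw [kernel_self n hn, inner, integral_gaussian] at h
  have hn0 : (n : ℂ) ≠ 0 := by exact_mod_cast (by omega : n ≠ 0)
  have hpi : (Real.pi : ℂ) ≠ 0 := by exact_mod_cast Real.pi_ne_zero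
  have e : ∀ z, (Real.exp (-‖z‖ ^ 2) / Real.pi) • (kernel n z 0 * conj (kernel n z 0)) =
      n * (berezinDensity n z : ℂ) := fun z => by
    have hz := exp_mul_kernel_mul_conj n 0 z
    rw [Complex.real_smul, Complex.ofReal_div, div_mul_eq_mul_div, hz, berezinDensity]
    simp
    field_simp
  simp_rw [e] at h
  rw [integral_const_mul, integral_complex_ofReal] at h
  have : (n : ℂ) * ((∫ z, berezinDensity n z : ℝ) : ℂ) = n * 1 := by
    rw [← h]; simp
  exact_mod_cast mul_left_cancel₀ hn0 this

/-- The zeros lie on finitely many circles, one for each root of the Laguerre polynomial, which is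
nonzero at `0`. -/
theorem ae_berezinDensity_ne_zero (n : ℕ) (hn : 1 ≤ n) : ∀ᵐ z, berezinDensity n z ≠ 0 := by
  obtain ⟨m, rfl⟩ := Nat.exists_eq_add_of_le' hn
  set P : Polynomial ℝ := ∑ j ∈ Finset.range (m + 1), Polynomial.C ((m + 1).choose (m - j) : ℝ) *
    ((-Polynomial.X) ^ j * Polynomial.C (j.factorial : ℝ)⁻¹) with hP
  have heval : ∀ t, P.eval t = laguerre 1 m t := fun t => by
    simp [hP, Polynomial.eval_finsetSum, laguerre, div_eq_mul_inv]
  have hP0 : P ≠ 0 := by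
    intro h
    have := heval 0
    rw [h, laguerre_one_zero, Polynomial.eval_zero] at this
    linarith [Nat.cast_nonneg (α := ℝ) m]
  have hsub : {z : ℂ | ¬ berezinDensity (m + 1) z ≠ 0} ⊆
      ⋃ t ∈ P.roots.toFinset, Metric.sphere (0 : ℂ) (Real.sqrt t) := by
    intro z hz
    have hL : laguerre 1 m (‖z‖ ^ 2) = 0 := by
      have : (m + 1 : ℝ) ≠ 0 := by positivity
      simpa [berezinDensity, this, Real.pi_ne_zero] using hz
    simp only [Set.mem_iUnion]
    refine ⟨‖z‖ ^ 2, ?_, by simp⟩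
    rw [Multiset.mem_toFinset, Polynomial.mem_roots hP0, Polynomial.IsRoot.def, heval, hL]
  refine measure_mono_null hsub ?_
  exact (measure_biUnion_null_iff (Finset.countable_toSet _)).2 fun t _ =>
    Measure.addHaar_sphere volume 0 _

/-- Convolution of an `L^p` function with `b_n`: integrability and a uniform bound. -/
theorem integrable_and_bounded_mul_berezinDensity (n : ℕ) {p : ENNReal} (hp : 1 ≤ p)
    {f : ℂ → ℂ} (hf : MemLp f p) : (∀ x, Integrable fun t => f t * (berezinDensity n (x - t) : ℂ)) ∧
      ∃ C, ∀ x, ‖∫ t, f t * (berezinDensity n (x - t) : ℂ)‖ ≤ C := by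
  obtain ⟨q, hq⟩ : ∃ q : ENNReal, p.HolderConjugate q :=
    ⟨_, ENNReal.HolderConjugate.conjExponent hp⟩
  have hb : MemLp (fun z => (berezinDensity n z : ℂ)) q := (memLp_berezinDensity n q).ofReal
  have hpres : ∀ x : ℂ, MeasurePreserving (fun t : ℂ => x - t) volume volume :=
    fun x => Measure.measurePreserving_sub_left volume x
  have hbx : ∀ x, MemLp (fun t => (berezinDensity n (x - t) : ℂ)) q :=
    fun x => hb.comp_measurePreserving (hpres x)
  have hi : ∀ x, Integrable fun t => f t * (berezinDensity n (x - t) : ℂ) :=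
    fun x => hf.integrable_mul (hbx x)
  refine ⟨hi, (eLpNorm f p volume * eLpNorm (fun z => (berezinDensity n z : ℂ)) q volume).toReal,
    fun x => ?_⟩
  have h1 : eLpNorm (f • fun t => (berezinDensity n (x - t) : ℂ)) 1 volume ≤
      eLpNorm f p volume * eLpNorm (fun t => (berezinDensity n (x - t) : ℂ)) q volume :=
    eLpNorm_smul_le_mul_eLpNorm (p := p) (q := q) (hbx x).1 hf.1
  have h2 : eLpNorm (fun t => (berezinDensity n (x - t) : ℂ)) q volume =
      eLpNorm (fun z => (berezinDensity n z : ℂ)) q volume :=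
    eLpNorm_comp_measurePreserving (g := fun z => (berezinDensity n z : ℂ))
      (f := fun t => x - t) hb.1 (hpres x)
  rw [h2] at h1
  have h3 : ‖∫ t, f t * (berezinDensity n (x - t) : ℂ)‖ₑ ≤
      eLpNorm (f • fun t => (berezinDensity n (x - t) : ℂ)) 1 volume := by
    rw [eLpNorm_one_eq_lintegral_enorm]
    exact enorm_integral_le_lintegral_enorm _
  have hfin := ENNReal.mul_ne_top hf.2.ne hb.2.ne
  rw [← toReal_enorm]
  exact ENNReal.toReal_mono hfin (h3.trans h1)

/-! ### The Berezin transform and its fixed points -/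

theorem smul_normalizedKernel_eq (n : ℕ) (hn : 1 ≤ n) (f : ℂ → ℂ) (z w : ℂ) :
    (Real.exp (-‖w‖ ^ 2) / Real.pi) •
      (f w * normalizedKernel n z w * conj (normalizedKernel n z w)) =
      f w * (berezinDensity n (z - w) : ℂ) := by
  rw [← berezinDensity_neg n (z - w), neg_sub, ← exp_div_pi_mul_normalizedKernel n hn z w,
    Complex.real_smul]
  ring

theorem berezin_apply (n : ℕ) (hn : 1 ≤ n) (f : ℂ → ℂ) (z : ℂ) :
    berezin n f z = ∫ w, f w * (berezinDensity n (z - w) : ℂ) := by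
  rw [berezin, inner, integral_gaussian]
  simp_rw [smul_normalizedKernel_eq n hn]

theorem berezin_congr_ae (n : ℕ) (hn : 1 ≤ n) {f g : ℂ → ℂ} (h : f =ᵐ[volume] g) :
    berezin n f = berezin n g := by
  ext z
  rw [berezin_apply n hn, berezin_apply n hn]
  exact integral_congr_ae (h.mono fun w hw => by simp only [hw])

theorem measurable_berezin (n : ℕ) (hn : 1 ≤ n) {f : ℂ → ℂ}
    (hf : AEStronglyMeasurable f volume) : Measurable (berezin n f) := by
  rw [berezin_congr_ae n hn hf.ae_eq_mk]
  have hm : Measurable (hf.mk f) := hf.stronglyMeasurable_mk.measurable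
  have hb : Measurable (berezinDensity n) := (continuous_berezinDensity n).measurable
  have : Measurable fun q : ℂ × ℂ => hf.mk f q.2 * (berezinDensity n (q.1 - q.2) : ℂ) := by
    fun_prop
  have e : berezin n (hf.mk f) =
      fun z => ∫ w, hf.mk f w * (berezinDensity n (z - w) : ℂ) := funext (berezin_apply n hn _)
  rw [e]
  exact this.stronglyMeasurable.integral_prod_right'.measurable

/-- Bounded fixed points of the Berezin transform are constant. -/
theorem eq_of_berezin_eq_self (n : ℕ) (hn : 1 ≤ n) {g : ℂ → ℂ} (hg : Measurable g) {C : ℝ}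
    (hC : ∀ x, ‖g x‖ ≤ C) (h : berezin n g = g) (x : ℂ) : g x = g 0 := by
  set ν : Measure ℂ := volume.withDensity fun z => ENNReal.ofReal (berezinDensity n z) with hν
  have hbm : Measurable (berezinDensity n) := (continuous_berezinDensity n).measurable
  have hbE : Measurable fun z => ENNReal.ofReal (berezinDensity n z) := hbm.ennreal_ofReal
  have : IsProbabilityMeasure ν := ⟨by
    rw [hν, withDensity_apply _ MeasurableSet.univ, Measure.restrict_univ,
      ← ofReal_integral_eq_lintegral_ofReal (integrable_berezinDensity n)
        (Filter.Eventually.of_forall (berezinDensity_nonneg n)), integral_berezinDensity n hn,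
      ENNReal.ofReal_one]⟩
  have hνint : ∀ s : ℂ → ℂ, ∫ y, s y ∂ν = ∫ y, s y * (berezinDensity n y : ℂ) := fun s => by
    rw [hν, integral_withDensity_eq_integral_toReal_smul hbE (by simp)]
    refine integral_congr_ae (Filter.Eventually.of_forall fun y => ?_)
    dsimp only
    rw [ENNReal.toReal_ofReal (berezinDensity_nonneg n y), Complex.real_smul, mul_comm]
  have hfix : ∀ x, g x = ∫ y, g (x - y) ∂ν := fun x => by
    rw [hνint, ← integral_sub_left_eq_self _ volume x]
    conv_lhs => rw [← h, berezin_apply n hn]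
    simp
  have hgi : ∀ x, Integrable (fun y => g (x - y)) ν := fun x =>
    Integrable.of_bound (hg.comp (measurable_const.sub measurable_id)).aestronglyMeasurable C
      (Filter.Eventually.of_forall fun y => hC _)
  have hae : ∀ x, ∀ᵐ y ∂(volume : Measure ℂ), g (x - y) = g x := fun x => by
    have hre := ae_sub_eq_of_eq_integral_sub (ν := ν) (Complex.measurable_re.comp hg)
      (fun x => (Complex.abs_re_le_norm _).trans (hC x))
      (fun x => (congrArg Complex.re (hfix x)).trans (integral_re (hgi x)).symm) x
    have him := ae_sub_eq_of_eq_integral_sub (ν := ν) (Complex.measurable_im.comp hg)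
      (fun x => (Complex.abs_im_le_norm _).trans (hC x))
      (fun x => (congrArg Complex.im (hfix x)).trans (integral_im (hgi x)).symm) x
    rw [hν, ae_withDensity_iff hbE] at hre him
    filter_upwards [hre, him, ae_berezinDensity_ne_zero n hn] with y h1 h2 h3
    have hpos : ENNReal.ofReal (berezinDensity n y) ≠ 0 := by
      simpa using lt_of_le_of_ne (berezinDensity_nonneg n y) h3.symm
    exact Complex.ext (h1 hpos) (h2 hpos)
  -- Since `0 - (y - x) = x - y`, almost every `y` links `g x` and `g 0` through the same value `g
  -- (x - y)`.
  have h0 : ∀ᵐ y ∂(volume : Measure ℂ), g (0 - (y - x)) = g 0 :=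
    (measurePreserving_sub_right volume x).quasiMeasurePreserving.ae (hae 0)
  obtain ⟨y, h1, h2⟩ := ((hae x).and h0).exists
  rw [← h1, ← h2]
  congr 1
  ring

/-- Harmonic functions in `L^p` are fixed by the Berezin transform. -/
theorem berezin_eq_self_of_harmonic (n : ℕ) (hn : 1 ≤ n) {p : ENNReal} (hp : 1 ≤ p)
    {f : ℂ → ℂ} (hf : MemLp f p) (h : InnerProductSpace.HarmonicOnNhd f Set.univ) :
    berezin n f = f := by
  have hfc : Continuous f := continuousOn_univ.1 h.continuousOn
  have hbc := continuous_berezinDensity n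
  set φ : ℝ → ℂ := fun r => (berezinDensity n (r : ℂ) : ℂ) with hφ
  have hφn : ∀ z : ℂ, φ ‖z‖ = (berezinDensity n z : ℂ) := fun z => by
    simp [hφ, berezinDensity]
  have hbi : Integrable fun z => (berezinDensity n z : ℂ) := (integrable_berezinDensity n).ofReal
  -- The total mass of `b_n` in polar coordinates.
  have hone : ∫ r in Set.Ioi (0 : ℝ), (2 * Real.pi * r : ℝ) • φ r = 1 := by
    have := integral_eq_integral_circleAverage (F := fun z => φ ‖z‖ * 1)
      (by simp only [hφn]; fun_prop)
      (by simpa only [hφn, mul_one] using hbi)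
    rw [setIntegral_congr_fun (g := fun r => (2 * Real.pi * r : ℝ) • φ r) measurableSet_Ioi] at this
    · rw [← this]
      simp only [hφn, mul_one]
      rw [integral_complex_ofReal, integral_berezinDensity n hn, Complex.ofReal_one]
    · intro r hr
      dsimp only
      rw [circleAverage_radial_mul φ (fun _ => 1) (le_of_lt hr), Real.circleAverage_const, mul_one]
  ext x
  have key : ∀ u, f (u + x) * (berezinDensity n (x - (u + x)) : ℂ) =
      φ ‖u‖ * f (u + x) := fun u => by
    rw [hφn, sub_add_cancel_right, berezinDensity_neg, mul_comm]
  have hint := ((integrable_and_bounded_mul_berezinDensity n hp hf).1 x).comp_add_right x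
  simp only [key] at hint
  rw [berezin_apply n hn, ← integral_add_right_eq_self _ x]
  simp only [key]
  rw [integral_eq_integral_circleAverage (by simp only [hφn]; fun_prop) hint,
    setIntegral_congr_fun (g := fun r => ((2 * Real.pi * r : ℝ) • φ r) * f x) measurableSet_Ioi,
    integral_mul_const, hone, one_mul]
  intro r hr
  dsimp only
  rw [circleAverage_radial_mul φ (fun u => f (u + x)) (le_of_lt hr),
    Real.circleAverage_map_add_const, (h.mono (Set.subset_univ _)).circleAverage_eq,
    smul_mul_assoc]

end

end PolyFock

open MeasureTheory in
theorem theorem1 (n : ℕ) (hn : 1 ≤ n) (p : ENNReal) (hp : 1 ≤ p)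
    (f : ℂ → ℂ) (hf : MemLp f p (volume : Measure ℂ)) :
    -- `K_n` is the reproducing kernel of the `n`-analytic Fock space
    PolyFock.IsReproducingKernel (PolyFock.fockSpace n) (PolyFock.kernel n) ∧
    -- `B_n f` is well defined at every point
    (∀ z, Integrable (fun w => f w * PolyFock.normalizedKernel n z w *
      (starRingEnd ℂ) (PolyFock.normalizedKernel n z w)) PolyFock.gaussian) ∧
    -- `B_n f = f * b_n`
    PolyFock.berezin n f =
      convolution f (fun z => (PolyFock.berezinDensity n z : ℂ))
        (ContinuousLinearMap.mul ℝ ℂ) volume ∧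
    -- the equivalence for `f` as an element of `L^p`, that is, up to null sets
    (PolyFock.berezin n f =ᵐ[volume] f ↔
      ∃ g : ℂ → ℂ, InnerProductSpace.HarmonicOnNhd g Set.univ ∧ f =ᵐ[volume] g) ∧
    -- the equivalence for `f` as a function
    (PolyFock.berezin n f = f ↔ InnerProductSpace.HarmonicOnNhd f Set.univ) := by
  obtain ⟨hint, C, hC⟩ := PolyFock.integrable_and_bounded_mul_berezinDensity n hp hf
  -- `f` may be unbounded, so Choquet–Deny is applied to `B_n f`, which is bounded and, since `B_n`
  -- ignores null sets, fixed at every point.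
  have hconst : PolyFock.berezin n f =ᵐ[volume] f →
      PolyFock.berezin n f = fun _ => PolyFock.berezin n f 0 := fun h =>
    funext <| PolyFock.eq_of_berezin_eq_self n hn (PolyFock.measurable_berezin n hn hf.1)
      (fun x => by rw [PolyFock.berezin_apply n hn]; exact hC x)
      (PolyFock.berezin_congr_ae n hn h)
  refine ⟨PolyFock.isReproducingKernel_kernel n hn, fun z => ?_, ?_, ⟨fun h => ?_, ?_⟩,
    fun h => ?_, PolyFock.berezin_eq_self_of_harmonic n hn hp hf⟩
  · rw [PolyFock.integrable_gaussian_iff]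
    simp_rw [PolyFock.smul_normalizedKernel_eq n hn]
    exact hint z
  · ext z
    rw [PolyFock.berezin_apply n hn, convolution_def]
    rfl
  · refine ⟨PolyFock.berezin n f, ?_, h.symm⟩
    rw [hconst h]
    exact InnerProductSpace.harmonicOnNhd_const _
  · rintro ⟨g, hg, hfg⟩
    rw [PolyFock.berezin_congr_ae n hn hfg,
      PolyFock.berezin_eq_self_of_harmonic n hn hp (hf.ae_eq hfg) hg]
    exact hfg.symm
  · have := hconst h.eventuallyEq
    rw [h] at this
    rw [this]
    exact InnerProductSpace.harmonicOnNhd_const _
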